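/- Let $(s(n))_{n\ge 0}$ be Stern's diatomic sequence, defined by $s(0)=0$, $s(1)=1$ and, for $n\ge 0$, $s(2n)=s(n)$ and $s(2n+1)=s(n)+s(n+1)$. Let $(b_n)_{n\ge 0}$ be the Baum–Sweet sequence, defined by $b_0=1$ and, for $n\ge 0$, $b_{4n}=b_{2n+1}=b_n$ and $b_{4n+2}=0$. Let $$S(z)=\sum_{n\ge 0}s(n)z^n,\qquad B(z)=\sum_{n\ge 0}b_nz^n$$ be their generating functions, regarded as elements of the field $\mathbb{C}((z))$ of formal Laurent series, which contains $\mathbb{C}(z)$ by Laurent expansion at $0$. Then $S(z)$ and $B(z)$ are algebraically independent over $\mathbb{C}(z)$; equivalently, $$\operatorname{tr.deg}_{\mathbb{C}(z)}\mathbb{C}(z)\bigl(S(z),B(z)\bigr)=2.$$ -/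

import Mathlib

open scoped LaurentSeries

/-- Stern's diatomic sequence: `s 0 = 0`, `s 1 = 1`, `s (2n) = s n`, `s (2n+1) = s n + s (n+1)`. -/
def sternSeq (n : ℕ) : ℕ :=
  if n = 0 then 0
  else if n = 1 then 1
  else if n % 2 = 0 then sternSeq (n / 2)
  else sternSeq (n / 2) + sternSeq (n / 2 + 1)
termination_by n
decreasing_by all_goals omega

/-- The Baum-Sweet sequence: `b 0 = 1`, `b (4n) = b (2n+1) = b n`, `b (4n+2) = 0`. -/
def baumSweetSeq (n : ℕ) : ℕ :=
  if n = 0 then 1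
  else if n % 2 = 1 then baumSweetSeq (n / 2)
  else if n % 4 = 0 then baumSweetSeq (n / 4)
  else 0
termination_by n
decreasing_by all_goals omega

theorem sternSeq_zero : sternSeq 0 = 0 := by
  rw [sternSeq]; simp

theorem sternSeq_one : sternSeq 1 = 1 := by
  rw [sternSeq]; simp

theorem sternSeq_two_mul (n : ℕ) : sternSeq (2 * n) = sternSeq n := by
  rcases Nat.eq_zero_or_pos n with rfl | hn
  · rfl
  · conv_lhs => rw [sternSeq]
    rw [if_neg (by omega), if_neg (by omega), if_pos (by omega)]
    congr 1
    omega

theorem sternSeq_two_mul_add_one (n : ℕ) :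
    sternSeq (2 * n + 1) = sternSeq n + sternSeq (n + 1) := by
  rcases Nat.eq_zero_or_pos n with rfl | hn
  · simp [sternSeq_zero]
  · conv_lhs => rw [sternSeq]
    rw [if_neg (by omega), if_neg (by omega), if_neg (by omega),
      show (2 * n + 1) / 2 = n by omega]

theorem baumSweetSeq_zero : baumSweetSeq 0 = 1 := by
  rw [baumSweetSeq]; simp

theorem baumSweetSeq_four_mul (n : ℕ) : baumSweetSeq (4 * n) = baumSweetSeq n := by
  rcases Nat.eq_zero_or_pos n with rfl | hn
  · rfl
  · conv_lhs => rw [baumSweetSeq]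
    rw [if_neg (by omega), if_neg (by omega), if_pos (by omega),
      show 4 * n / 4 = n by omega]

theorem baumSweetSeq_two_mul_add_one (n : ℕ) :
    baumSweetSeq (2 * n + 1) = baumSweetSeq n := by
  conv_lhs => rw [baumSweetSeq]
  rw [if_neg (by omega), if_pos (by omega), show (2 * n + 1) / 2 = n by omega]

theorem baumSweetSeq_four_mul_add_two (n : ℕ) : baumSweetSeq (4 * n + 2) = 0 := by
  rw [baumSweetSeq, if_neg (by omega), if_neg (by omega), if_neg (by omega)]

/-- Stern's generating function `S(z) = ∑ s(n) zⁿ`, as a power series over `ℂ`. -/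
noncomputable def sternSeries : PowerSeries ℂ :=
  PowerSeries.mk fun n => (sternSeq n : ℂ)

/-- The Baum-Sweet generating function `B(z) = ∑ b(n) zⁿ`, as a power series over `ℂ`. -/
noncomputable def baumSweetSeries : PowerSeries ℂ :=
  PowerSeries.mk fun n => (baumSweetSeq n : ℂ)

/-- The field of formal Laurent series `ℂ((z))` as an extension of the field `ℂ(z)` of rational
functions: a rational function acts through its Laurent expansion at `0`. This is Mathlib's scoped
instance, activated for this one field only. -/
noncomputable instance ratFuncAlgebraLaurentSeries : Algebra (RatFunc ℂ) (LaurentSeries ℂ) :=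
  RatFunc.liftAlgebra ℂ (LaurentSeries ℂ)

/-! ### Binary forms over `ℂ[z]`: the degree argument -/

section MahlerForms

open Polynomial

/-! Let `τ` be the substitution z ↦ z². Then `τ S = a S` with a = z/(1+z+z²), and u = `τ B`/B
satisfies the Riccati equation `τ u` = 1/u - z. In a relation among S and B with coefficients in
K[u], K = ℂ(z), and as few monomials as possible, applying `τ` and eliminating one monomial forces
all coefficients to be proportional to their transforms
(`algebraicIndependent_of_forall_skewForm_ne`). If two monomials occur, the ratio of their
coefficients is semi-invariant up to powers of u and a.

Three facts exclude this. No form of positive degree is semi-invariant under U ↦ 1/U - z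
(`skewForm_ne_C_mul`), so such a ratio lies in K and the powers of u agree; multiplicities at the
primitive cube roots of unity then make the powers of a agree (`exponents_eq_of_expand_mul_eq`); and
a single monomial cannot vanish because u is transcendental. The argument in fact gives independence
of u, S and B. -/

/-- A polynomial of degree at most `N`, reflected in degree `N`, as an explicit sum. -/
theorem Polynomial.reflect_eq_sum {R : Type*} [CommRing R] (P : R[X]) {N : ℕ}
    (hN : P.natDegree ≤ N) :
    reflect N P = ∑ k ∈ Finset.range (N + 1), C (P.coeff k) * X ^ (N - k) := by
  have key : ∀ s : Finset ℕ, (∀ k ∈ s, k ≤ N) →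
      reflect N (∑ k ∈ s, C (P.coeff k) * X ^ k) = ∑ k ∈ s, C (P.coeff k) * X ^ (N - k) := by
    intro s
    induction s using Finset.induction_on with
    | empty => simp
    | insert a s ha ih =>
      intro hs
      rw [Finset.sum_insert ha, Finset.sum_insert ha, reflect_add, reflect_C_mul_X_pow,
        ih fun k hk => hs k (Finset.mem_insert_of_mem hk),
        revAt_le (hs a (Finset.mem_insert_self a s))]
  conv_lhs => rw [P.as_sum_range_C_mul_X_pow' (Nat.lt_succ_of_le hN)]
  exact key _ fun k hk => Nat.lt_succ_iff.mp (Finset.mem_range.mp hk)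

/-- If `p(-x) = ± p(x)` and `(x + 1) ^ m ∣ p`, then `p` has degree at least `2 * m`. -/
theorem Polynomial.two_mul_le_natDegree_of_parity {p : ℂ[X]} (hp : p ≠ 0) {n m : ℕ}
    (hpar : ∀ k, p.coeff k ≠ 0 → Even (n + k)) (hdvd : (X + 1) ^ m ∣ p) :
    2 * m ≤ p.natDegree := by
  have hcomp : p.comp (-X) = (-1) ^ n * p := by
    ext k
    have h1 : p.comp (-X) = p.comp (C (-1) * X) := by simp
    have h2 : ((-1 : ℂ[X]) ^ n) = C ((-1 : ℂ) ^ n) := by simp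
    rw [h1, comp_C_mul_X_coeff, h2, coeff_C_mul]
    by_cases hk : p.coeff k = 0
    · simp [hk]
    · have := hpar k hk
      rw [mul_comm]
      congr 1
      exact neg_one_pow_congr (Nat.even_add.mp this).symm
  have hdvd' : (X - 1) ^ m ∣ p := by
    obtain ⟨q, hq⟩ := hdvd
    have h3 : (-1) ^ n * p = (-X + 1) ^ m * q.comp (-X) := by
      rw [← hcomp, hq]; simp
    have h4 : p = (X - 1) ^ m * ((-1) ^ n * (-1) ^ m * q.comp (-X)) := by
      have h5 : ((-1 : ℂ[X]) ^ n) * (-1) ^ n = 1 := by rw [← mul_pow]; simp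
      calc p = (-1) ^ n * ((-1) ^ n * p) := by rw [← mul_assoc, h5, one_mul]
        _ = _ := by
          rw [h3, show (-X + 1 : ℂ[X]) = (-1) * (X - 1) by ring, mul_pow]; ring
    exact ⟨_, h4⟩
  have hco : IsCoprime ((X + 1 : ℂ[X]) ^ m) ((X - 1) ^ m) := by
    apply IsCoprime.pow
    refine ⟨C (1 / 2), - C (1 / 2), ?_⟩
    have : (C (1 / 2) : ℂ[X]) * 2 = 1 := by
      rw [← C_ofNat, ← C_mul]; norm_num
    linear_combination this
  have h6 := natDegree_le_of_dvd (hco.mul_dvd hdvd hdvd') hp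
  have h7 : (X + 1 : ℂ[X]).natDegree = 1 := natDegree_X_add_C 1
  have h8 : (X - 1 : ℂ[X]).natDegree = 1 := natDegree_X_sub_C 1
  have h9 : (X + 1 : ℂ[X]).Monic := monic_X_add_C 1
  have h10 : (X - 1 : ℂ[X]).Monic := monic_X_sub_C 1
  rw [(h9.pow m).natDegree_mul (h10.pow m), h9.natDegree_pow, h10.natDegree_pow, h7, h8] at h6
  omega

/-- The equation `Q(z², U) = c * Q*(z, U + z)`, where `Q*` is the reflection of `Q` in degree `N`,
has no nonzero polynomial solution `Q` when `N > 0`. -/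
theorem not_expand_eq_taylor_reflect {Q : ℂ[X][X]} {N : ℕ} (hN : Q.natDegree ≤ N) (hpos : 0 < N)
    (hQ : Q ≠ 0) {c : ℂ}
    (h : Q.map (expand ℂ 2 : ℂ[X] →+* ℂ[X]) = C (C c) * taylor X (reflect N Q)) : False := by
  -- Substitute U = xz, with x the inner and z the outer variable, so G = ∑ x^k Q_k(z²) z^k. Since U
  -- + z = (x+1)z, the equation also gives G = c ∑ (x+1)^(N-k) Q_k(z) z^(N-k).
  set G : ℂ[X][X] := ∑ k ∈ Finset.range (N + 1),
    C (X ^ k) * ((expand ℂ 2 (Q.coeff k)).map C * X ^ k) with hG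
  have hGR : G = ∑ k ∈ Finset.range (N + 1),
      C (C c * (X + 1) ^ (N - k)) * (((Q.coeff k) * X ^ (N - k)).map C) := by
    have hΨ := congrArg (eval₂RingHom (mapRingHom (C : ℂ →+* ℂ[X])) (C X * X)) h
    rw [reflect_eq_sum Q hN] at hΨ
    conv_lhs at hΨ => rw [Q.as_sum_range_C_mul_X_pow' (Nat.lt_succ_of_le hN)]
    simp only [Polynomial.map_sum, map_sum, Polynomial.map_mul, map_mul, Polynomial.map_pow,
      map_pow, map_C, map_X, coe_eval₂RingHom, eval₂_C, eval₂_X, taylor_C, taylor_X, taylor_mul,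
      taylor_pow, eval₂_add, coe_mapRingHom, Finset.mul_sum, RingHom.coe_coe] at hΨ
    rw [hG]
    calc _ = _ := Finset.sum_congr rfl fun k _ => ?_
      _ = _ := hΨ
      _ = _ := Finset.sum_congr rfl fun k _ => ?_
    · rw [mul_pow, C_pow]; ring
    · rw [show (C X * X + X : ℂ[X][X]) = C (X + 1) * X by simp; ring, mul_pow]
      simp only [Polynomial.map_mul, Polynomial.map_pow, map_X, C_mul, C_pow]
      ring
  have hcoeff : ∀ n k, k ≤ N →
      (G.coeff n).coeff k = if k ≤ n then (expand ℂ 2 (Q.coeff k)).coeff (n - k) else 0 := by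
    intro n k hk
    rw [hG, finsetSum_coeff, finsetSum_coeff, Finset.sum_eq_single k]
    · rw [coeff_C_mul, coeff_mul_X_pow', coeff_X_pow_mul']
      simp only [le_refl, if_true, Nat.sub_self]
      split_ifs <;> simp
    · intro j _ hj
      rw [coeff_C_mul, coeff_mul_X_pow']
      split_ifs with hjn
      · rw [coeff_map, mul_comm, coeff_C_mul, coeff_X_pow, if_neg (Ne.symm hj), mul_zero]
      · simp
    · intro hk'
      exact absurd (Finset.mem_range.mpr (Nat.lt_succ_of_le hk)) hk'
  have hdegN : ∀ n, (G.coeff n).natDegree ≤ N := by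
    intro n
    rw [hG, finsetSum_coeff]
    refine natDegree_sum_le_of_forall_le _ _ fun k hk => ?_
    rw [coeff_C_mul, coeff_mul_X_pow']
    split_ifs with hkn
    · rw [coeff_map, mul_comm]
      exact (natDegree_C_mul_X_pow_le _ _).trans (Nat.lt_succ_iff.mp (Finset.mem_range.mp hk))
    · simp
  have hdouble' : ∀ k a, (Q.coeff k).coeff a ≠ 0 → G.coeff (2 * a + k) ≠ 0 := by
    intro k a ha h0
    have hk : k ≤ N := by
      by_contra hk
      rw [coeff_eq_zero_of_natDegree_lt (show Q.natDegree < k by omega)] at ha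
      simp at ha
    have := hcoeff (2 * a + k) k hk
    rw [h0, if_pos (by omega), Nat.add_sub_cancel, mul_comm 2 a, coeff_expand_mul two_pos] at this
    exact ha (by simpa using this.symm)
  have hdouble : ∀ k a, (Q.coeff k).coeff a ≠ 0 → 2 * a + k ≤ G.natDegree := fun k a ha =>
    le_natDegree_of_ne_zero (hdouble' k a ha)
  have hG0 : G ≠ 0 := by
    obtain ⟨k, hk⟩ := Polynomial.ext_iff.not.mp hQ |> not_forall.mp
    obtain ⟨a, ha⟩ := Polynomial.ext_iff.not.mp hk |> not_forall.mp
    intro h0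
    exact hdouble' k a (by simpa using ha) (by rw [h0, coeff_zero])
  -- p(x) is the leading coefficient of G in z. The first expression for G gives p the parity of n,
  -- the second exhibits powers of x + 1.
  set n := G.natDegree with hn
  set p := G.coeff n with hp
  have hp0 : p ≠ 0 := leadingCoeff_ne_zero.mpr hG0
  have hpsum : p = ∑ k ∈ Finset.range (N + 1),
      C c * (X + 1) ^ (N - k) * C ((Q.coeff k * X ^ (N - k)).coeff n) := by
    rw [hp, hGR, finsetSum_coeff]
    exact Finset.sum_congr rfl fun k _ => by rw [coeff_C_mul, coeff_map]
  let s := (Finset.range (N + 1)).filter fun k => (Q.coeff k * X ^ (N - k)).coeff n ≠ 0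
  have hs : s.Nonempty := by
    by_contra hs
    rw [Finset.not_nonempty_iff_eq_empty, Finset.filter_eq_empty_iff] at hs
    apply hp0
    rw [hpsum]
    exact Finset.sum_eq_zero fun k hk => by rw [not_not.mp (hs hk), C_0, mul_zero]
  obtain ⟨hκr, hκ⟩ := Finset.mem_filter.mp (s.max'_mem hs)
  set κ := s.max' hs
  have hκN : κ ≤ N := Nat.lt_succ_iff.mp (Finset.mem_range.mp hκr)
  have hdvd : (X + 1) ^ (N - κ) ∣ p := by
    rw [hpsum]
    refine Finset.dvd_sum fun k hk => ?_
    by_cases hk0 : (Q.coeff k * X ^ (N - k)).coeff n = 0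
    · rw [hk0, C_0, mul_zero]; exact dvd_zero _
    · have : k ≤ κ := s.le_max' k (Finset.mem_filter.mpr ⟨hk, hk0⟩)
      exact ((pow_dvd_pow _ (by omega)).mul_left _).mul_right _
  have hpk : ∀ k, p.coeff k ≠ 0 → k ≤ n ∧ Even (n + k) := by
    intro k hk
    have hkN : k ≤ N := (le_natDegree_of_ne_zero hk).trans (hdegN n)
    rw [hp, hcoeff n k hkN, coeff_expand two_pos] at hk
    split_ifs at hk with h1 h2
    · exact ⟨h1, by rw [Nat.even_iff]; omega⟩
    · exact absurd rfl hk
    · exact absurd rfl hk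
  -- With d = deg p, these bounds read 2(N-κ) ≤ d ≤ min(n, N). The term of Q at κ contributes
  -- 2(n-N+κ) + κ ≤ n, that is n ≤ 2N - 3κ. Hence κ = 0, and then 2N ≤ N.
  have h2 := two_mul_le_natDegree_of_parity hp0 (fun k hk => (hpk k hk).2) hdvd
  have h3 : p.natDegree ≤ n := (hpk _ (leadingCoeff_ne_zero.mpr hp0)).1
  have h4 := hdegN n
  rw [← hp] at h4
  rw [coeff_mul_X_pow'] at hκ
  split_ifs at hκ with h5
  · have h6 := hdouble κ _ hκ
    omega
  · exact absurd rfl hκ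

end MahlerForms

/-! ### Absence of semi-invariant forms over `ℂ(z)` -/

section MahlerForms

open Polynomial

/-- The action of a difference operator on binary forms of degree `N`, in an affine coordinate:
`P(U)` is sent to `U ^ N * P^σ(1 / U - z)`, where `P^σ` is obtained by applying `σ` to the
coefficients of `P`. -/
noncomputable def Polynomial.skewForm {R : Type*} [CommRing R] (σ : R →+* R) (z : R) (N : ℕ)
    (P : R[X]) : R[X] :=
  reflect N (taylor (-z) (P.map σ))

/-- Otherwise z - w would divide the content. -/
theorem Polynomial.IsPrimitive.map_evalRingHom_ne_zero {Q : ℂ[X][X]} (hQ : Q.IsPrimitive) (w : ℂ) :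
    Q.map (evalRingHom w) ≠ 0 := by
  intro h
  have hdvd : C (X - C w) ∣ Q := by
    rw [C_dvd_iff_dvd_coeff]
    intro k
    rw [dvd_iff_isRoot, IsRoot.def]
    simpa using congrArg (fun p => p.coeff k) h
  exact not_isUnit_X_sub_C w (hQ _ hdvd)

theorem Polynomial.exists_eq_C_mul_map_primitive {P : (RatFunc ℂ)[X]} (hP : P ≠ 0) :
    ∃ (d : RatFunc ℂ) (Q : ℂ[X][X]), d ≠ 0 ∧ Q.IsPrimitive ∧
      P = C d * Q.map (algebraMap ℂ[X] (RatFunc ℂ)) := by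
  obtain ⟨b, hb, h⟩ := IsLocalization.integerNormalization_spec (nonZeroDivisors ℂ[X]) P
  set Q := IsLocalization.integerNormalization (nonZeroDivisors ℂ[X]) P
  have hb0 : algebraMap ℂ[X] (RatFunc ℂ) b ≠ 0 :=
    IsFractionRing.to_map_ne_zero_of_mem_nonZeroDivisors hb
  rw [Algebra.smul_def, algebraMap_apply] at h
  have hP' : P = C ((algebraMap ℂ[X] (RatFunc ℂ) b)⁻¹ * algebraMap ℂ[X] (RatFunc ℂ) Q.content) *
      Q.primPart.map (algebraMap ℂ[X] (RatFunc ℂ)) := by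
    rw [C_mul, mul_assoc, ← map_C (algebraMap ℂ[X] (RatFunc ℂ)), ← Polynomial.map_mul,
      ← Q.eq_C_content_mul_primPart, h, ← mul_assoc, ← C_mul]
    simp [hb0]
  refine ⟨_, _, ?_, Q.isPrimitive_primPart, hP'⟩
  intro h0
  rw [h0, C_0, zero_mul] at hP'
  exact hP hP'

/-- No binary form of positive degree over `ℂ(z)` is semi-invariant for `z ↦ z²` and
`U ↦ 1 / U - z`. -/
theorem skewForm_ne_C_mul {σ : RatFunc ℂ →+* RatFunc ℂ}
    (hσ : ∀ p : ℂ[X], σ (algebraMap ℂ[X] (RatFunc ℂ) p) =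
      algebraMap ℂ[X] (RatFunc ℂ) (expand ℂ 2 p))
    {P : (RatFunc ℂ)[X]} {N : ℕ} (hP : P ≠ 0) (hN : P.natDegree ≤ N) (hpos : 0 < N)
    (γ : RatFunc ℂ) : skewForm σ RatFunc.X N P ≠ C γ * P := by
  intro h
  obtain ⟨d, Q, hd, hQ, rfl⟩ := exists_eq_C_mul_map_primitive hP
  have hinj : Function.Injective (algebraMap ℂ[X] (RatFunc ℂ)) := IsFractionRing.injective _ _
  have hσd : σ d ≠ 0 := (map_ne_zero σ).mpr hd
  have hQN : Q.natDegree ≤ N := by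
    rwa [natDegree_C_mul hd, natDegree_map_eq_of_injective hinj] at hN
  have hinv : (C d * Q.map (algebraMap ℂ[X] (RatFunc ℂ))).map σ =
      C γ * taylor RatFunc.X (reflect N (C d * Q.map (algebraMap ℂ[X] (RatFunc ℂ)))) := by
    have := congrArg (fun p => taylor RatFunc.X (reflect N p)) h
    simp only [skewForm, reflect_reflect, taylor_taylor, reflect_C_mul, taylor_mul, taylor_C,
      add_neg_cancel, taylor_zero] at this
    rw [this, reflect_C_mul, taylor_mul, taylor_C]
  set e : RatFunc ℂ := γ * d / σ d with he
  have hcomp : (Q.map (algebraMap ℂ[X] (RatFunc ℂ))).map σ =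
      (Q.map (expand ℂ 2 : ℂ[X] →+* ℂ[X])).map (algebraMap ℂ[X] (RatFunc ℂ)) := by
    rw [Polynomial.map_map, Polynomial.map_map]
    congr 1
    exact RingHom.ext hσ
  have hde : e * algebraMap ℂ[X] (RatFunc ℂ) e.denom = algebraMap ℂ[X] (RatFunc ℂ) e.num := by
    have h0 : algebraMap ℂ[X] (RatFunc ℂ) e.denom ≠ 0 :=
      fun h0 => e.denom_ne_zero (hinj (by rw [h0, map_zero]))
    exact ((div_eq_iff h0).mp (RatFunc.num_div_denom e)).symm
  -- Undoing the reflection and the shift turns semi-invariance into an equation over `ℂ[z]`, up to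
  -- the factor `e`.
  have hint : C e.denom * Q.map (expand ℂ 2 : ℂ[X] →+* ℂ[X]) =
      C e.num * taylor X (reflect N Q) := by
    apply map_injective _ hinj
    rw [Polynomial.map_mul, Polynomial.map_mul, map_C, map_C, map_taylor, ← hcomp,
      RatFunc.algebraMap_X, ← reflect_map, ← hde]
    rw [Polynomial.map_mul, map_C, reflect_C_mul, taylor_mul, taylor_C] at hinv
    have h1 : (Q.map (algebraMap ℂ[X] (RatFunc ℂ))).map σ =
        C e * taylor RatFunc.X (reflect N (Q.map (algebraMap ℂ[X] (RatFunc ℂ)))) := by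
      have : C (σ d)⁻¹ * C (σ d) = (1 : (RatFunc ℂ)[X]) := by
        rw [← C_mul, inv_mul_cancel₀ hσd, C_1]
      calc _ = C (σ d)⁻¹ * (C (σ d) * (Q.map (algebraMap ℂ[X] (RatFunc ℂ))).map σ) := by
            rw [← mul_assoc, this, one_mul]
        _ = _ := by
          rw [hinv, he, div_eq_mul_inv, C_mul, C_mul]; ring
    rw [h1, C_mul]
    ring
  have heval : ∀ w : ℂ, C (e.denom.eval w) * Q.map (evalRingHom (w ^ 2)) =
      C (e.num.eval w) * taylor w (reflect N (Q.map (evalRingHom w))) := by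
    intro w
    have := congrArg (Polynomial.map (evalRingHom w)) hint
    rw [Polynomial.map_mul, Polynomial.map_mul, map_C, map_C, map_taylor, ← reflect_map,
      Polynomial.map_map] at this
    have hc : (evalRingHom w).comp (expand ℂ 2 : ℂ[X] →+* ℂ[X]) = evalRingHom (w ^ 2) := by
      ext <;> simp
    rw [hc] at this
    simpa using this
  have hcop := e.isCoprime_num_denom
  have hboth : ∀ w : ℂ, e.denom.eval w = 0 → e.num.eval w = 0 → False := by
    intro w h1 h2
    obtain ⟨a, b, hab⟩ := hcop
    simpa [h1, h2] using congrArg (eval w) hab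
  -- At a zero w of the denominator the numerator is nonzero, so the specialization of Q at z = w
  -- would vanish, against primitivity. A zero of the numerator would kill Q at w² instead. Hence
  -- `e` is constant.
  have hdenom : e.denom.degree = 0 := by
    by_contra hdeg
    obtain ⟨w, hw⟩ := IsAlgClosed.exists_root _ hdeg
    have := heval w
    rw [IsRoot.def.mp hw, C_0, zero_mul, eq_comm, mul_eq_zero, C_eq_zero] at this
    rcases this with h1 | h1
    · exact hboth w hw h1
    · rw [taylor_eq_zero, reflect_eq_zero_iff] at h1
      exact hQ.map_evalRingHom_ne_zero w h1
  have hnum : e.num.degree = 0 := by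
    by_contra hdeg
    obtain ⟨w, hw⟩ := IsAlgClosed.exists_root _ hdeg
    have := heval w
    rw [IsRoot.def.mp hw, C_0, zero_mul, mul_eq_zero, C_eq_zero] at this
    rcases this with h1 | h1
    · exact hboth w h1 hw
    · exact hQ.map_evalRingHom_ne_zero _ h1
  rw [eq_C_of_degree_eq_zero hnum, eq_C_of_degree_eq_zero hdenom] at hint
  set a := e.num.coeff 0
  set b := e.denom.coeff 0 with hb
  have hb0 : b ≠ 0 := by
    intro hb0
    rw [eq_C_of_degree_eq_zero hdenom, ← hb, hb0, C_0, degree_zero] at hdenom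
    exact absurd hdenom (by simp)
  refine not_expand_eq_taylor_reflect hQN hpos hQ.ne_zero (c := b⁻¹ * a) ?_
  have : C (C b⁻¹) * C (C b) = (1 : ℂ[X][X]) := by
    rw [← C_mul, ← C_mul, inv_mul_cancel₀ hb0, C_1, C_1]
  calc _ = C (C b⁻¹) * (C (C b) * Q.map (expand ℂ 2 : ℂ[X] →+* ℂ[X])) := by
        rw [← mul_assoc, this, one_mul]
    _ = _ := by rw [hint, ← mul_assoc, ← C_mul, ← C_mul]

end MahlerForms

/-! ### Semi-invariant forms and the independence criterion -/

section SkewForms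

open Polynomial

variable {K L : Type*} [Field K] [Field L] [Algebra K L] {σ : K →+* K} {z : K}

namespace Polynomial

theorem natDegree_taylor_map (P : K[X]) : (taylor (-z) (P.map σ)).natDegree = P.natDegree := by
  rw [natDegree_taylor, natDegree_map]

theorem skewForm_mul {P Q : K[X]} {M N : ℕ} (hP : P.natDegree ≤ M) (hQ : Q.natDegree ≤ N) :
    skewForm σ z (M + N) (P * Q) = skewForm σ z M P * skewForm σ z N Q := by
  rw [skewForm, Polynomial.map_mul, taylor_mul, reflect_mul _ _ (by rwa [natDegree_taylor_map])
    (by rwa [natDegree_taylor_map])]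
  rfl

theorem skewForm_add (P Q : K[X]) (N : ℕ) :
    skewForm σ z N (P + Q) = skewForm σ z N P + skewForm σ z N Q := by
  simp only [skewForm, Polynomial.map_add, map_add, reflect_add]

theorem skewForm_one (N : ℕ) : skewForm σ z N (1 : K[X]) = X ^ N := by
  simp [skewForm]

/-- Raising the formal degree by J multiplies the form by the J-th power of the homogenizing
variable, which the transformation sends to X^J. -/
theorem skewForm_add_right {P : K[X]} {N : ℕ} (hP : P.natDegree ≤ N) (J : ℕ) :
    skewForm σ z (N + J) P = skewForm σ z N P * X ^ J := by
  conv_lhs => rw [← mul_one P]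
  rw [skewForm_mul hP (by simp), skewForm_one]

theorem skewForm_zero_C (p : K) : skewForm σ z 0 (C p) = C (σ p) := by
  simp [skewForm]

theorem skewForm_eq_zero_iff {P : K[X]} {N : ℕ} : skewForm σ z N P = 0 ↔ P = 0 := by
  rw [skewForm, reflect_eq_zero_iff, taylor_eq_zero,
    Polynomial.map_eq_zero]

theorem natDegree_skewForm_le {P : K[X]} {N : ℕ} (hP : P.natDegree ≤ N) :
    (skewForm σ z N P).natDegree ≤ N := by
  refine natDegree_reflect_le.trans ?_
  rw [natDegree_taylor_map]
  exact max_le le_rfl hP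

theorem skewForm_coeff_zero {P : K[X]} (hP : P ≠ 0) :
    (skewForm σ z P.natDegree P).coeff 0 ≠ 0 := by
  rw [skewForm, coeff_reflect, revAt_zero, ← natDegree_taylor_map (σ := σ) (z := z) P,
    coeff_natDegree, leadingCoeff_ne_zero, Ne, taylor_eq_zero, Polynomial.map_eq_zero]
  exact hP

/-- Evaluation of a transformed form at a solution `u` of the Riccati equation
`σ u = 1 / u - z`. -/
theorem aeval_skewForm {τ : L →+* L} (hτ : ∀ k, τ (algebraMap K L k) = algebraMap K L (σ k))
    {u : L} (hu : u * τ u = 1 - algebraMap K L z * u) {P : K[X]} {N : ℕ} (hP : P.natDegree ≤ N) :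
    aeval u (skewForm σ z N P) = u ^ N * τ (aeval u P) := by
  have hu0 : u ≠ 0 := by rintro rfl; simp at hu
  let _ : Invertible u⁻¹ := invertibleOfNonzero (inv_ne_zero hu0)
  have h := eval₂_reflect_mul_pow (algebraMap K L) u⁻¹ N (taylor (-z) (P.map σ))
    (by rwa [natDegree_taylor_map])
  rw [invOf_eq_inv, inv_inv, taylor_apply, eval₂_comp, eval₂_map] at h
  have hτu : eval₂ (algebraMap K L) u⁻¹ (X + C (-z)) = τ u := by
    rw [eval₂_add, eval₂_X, eval₂_C, map_neg]
    field_simp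
    linear_combination -hu
  have hcomp : (algebraMap K L).comp σ = τ.comp (algebraMap K L) := by
    ext k; simp [hτ]
  rw [hτu, hcomp, ← hom_eval₂] at h
  rw [aeval_def, aeval_def, ← h, inv_pow, mul_comm, mul_assoc, inv_mul_cancel₀ (pow_ne_zero _ hu0),
    mul_one]
  rfl

end Polynomial

/-- A solution of the Riccati equation `σ u = 1 / u - z` is transcendental when there are no
semi-invariant forms of positive degree. -/
theorem transcendental_of_forall_skewForm_ne {τ : L →+* L}
    (hτ : ∀ k, τ (algebraMap K L k) = algebraMap K L (σ k))
    {u : L} (hu : u * τ u = 1 - algebraMap K L z * u)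
    (hform : ∀ (P : K[X]) (N : ℕ), P ≠ 0 → P.natDegree ≤ N → 0 < N → ∀ γ : K,
      skewForm σ z N P ≠ C γ * P) : Transcendental K u := by
  intro halg
  have hint : IsIntegral K u := halg.isIntegral
  have h0 : aeval u (skewForm σ z (minpoly K u).natDegree (minpoly K u)) = 0 := by
    rw [aeval_skewForm hτ hu le_rfl, minpoly.aeval, map_zero, mul_zero]
  obtain ⟨T, hT⟩ := minpoly.dvd K u h0
  have hne := minpoly.ne_zero hint
  have hT0 : T ≠ 0 := by
    rintro rfl
    rw [mul_zero, skewForm_eq_zero_iff] at hT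
    exact hne hT
  have hdeg := natDegree_skewForm_le (σ := σ) (z := z) (le_refl (minpoly K u).natDegree)
  -- The transform has no larger degree than the minimal polynomial dividing it, so the cofactor is
  -- constant.
  rw [hT, natDegree_mul hne hT0] at hdeg
  rw [eq_C_of_natDegree_eq_zero (show T.natDegree = 0 by omega), mul_comm] at hT
  exact hform _ _ hne le_rfl (minpoly.natDegree_pos hint) _ hT

/-- Coprime forms whose quotient is semi-invariant have degree zero when there are no
semi-invariant forms of positive degree. The two forms are coprime at infinity because one of the
formal degrees is the actual degree. -/
theorem eq_zero_of_isCoprime_of_skewForm_mul_eq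
    (hform : ∀ (P : K[X]) (N : ℕ), P ≠ 0 → P.natDegree ≤ N → 0 < N → ∀ γ : K,
      skewForm σ z N P ≠ C γ * P)
    {P Q : K[X]} (hP : P ≠ 0) (hQ : Q ≠ 0) (hPQ : IsCoprime P Q) {m n : ℕ}
    (hm : P.natDegree ≤ m) (hn : Q.natDegree ≤ n) (hmn : m = P.natDegree ∨ n = Q.natDegree)
    {α β : K} (hβ : β ≠ 0)
    (h : skewForm σ z m P * C α * Q = P * skewForm σ z n Q * C β) : m = 0 ∧ n = 0 := by
  have hdvd : P ∣ skewForm σ z m P * C α := by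
    refine hPQ.dvd_of_dvd_mul_right ?_
    rw [h, mul_assoc]
    exact dvd_mul_right _ _
  have hα : α ≠ 0 := by
    rintro rfl
    rw [C_0, mul_zero, zero_mul, eq_comm] at h
    simp [hP, hβ, skewForm_eq_zero_iff, hQ] at h
  obtain ⟨T, hT⟩ := hdvd
  have hCα : C α * C α⁻¹ = (1 : K[X]) := by rw [← C_mul, mul_inv_cancel₀ hα, C_1]
  have hCβ : C β * C β⁻¹ = (1 : K[X]) := by rw [← C_mul, mul_inv_cancel₀ hβ, C_1]
  have hTP : skewForm σ z m P = T * C α⁻¹ * P := by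
    linear_combination C α⁻¹ * hT - skewForm σ z m P * hCα
  have hTQ : skewForm σ z n Q = T * C β⁻¹ * Q := by
    have h1 : skewForm σ z n Q * C β = T * Q := by
      apply mul_left_cancel₀ hP
      rw [← mul_assoc, ← h, hT, mul_assoc]
    linear_combination C β⁻¹ * h1 - skewForm σ z n Q * hCβ
  have hTdP : T ∣ skewForm σ z m P := ⟨C α⁻¹ * P, by rw [hTP, mul_assoc]⟩
  have hTdQ : T ∣ skewForm σ z n Q := ⟨C β⁻¹ * Q, by rw [hTQ, mul_assoc]⟩
  -- Transforming a Bézout relation gives X^M, the transform of 1, as a combination of the two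
  -- transforms, both divisible by T.
  have hTX : ∃ M, T ∣ X ^ M := by
    obtain ⟨x, y, hxy⟩ := hPQ
    refine ⟨(x.natDegree + n + (y.natDegree + m)), ?_⟩
    rw [← skewForm_one (σ := σ) (z := z), ← hxy, skewForm_add]
    apply dvd_add
    · rw [show x.natDegree + n + (y.natDegree + m) = (x.natDegree + n + y.natDegree) + m by ring,
        skewForm_mul (by omega) hm]
      exact hTdP.mul_left _
    · rw [show x.natDegree + n + (y.natDegree + m) = (x.natDegree + y.natDegree + m) + n by ring,
        skewForm_mul (by omega) hn]
      exact hTdQ.mul_left _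
  obtain ⟨M, hM⟩ := hTX
  obtain ⟨k, -, hk⟩ := (dvd_prime_pow prime_X M).mp hM
  -- The form whose formal degree is exact has a transform with nonzero constant term, so X does not
  -- divide T.
  have hk0 : k = 0 := by
    by_contra hk0
    have hXT : X ∣ T := (dvd_pow_self X hk0).trans hk.symm.dvd
    rcases hmn with rfl | rfl
    · exact skewForm_coeff_zero hP (X_dvd_iff.mp (hXT.trans hTdP))
    · exact skewForm_coeff_zero hQ (X_dvd_iff.mp (hXT.trans hTdQ))
  rw [hk0, pow_zero, associated_one_iff_isUnit, isUnit_iff] at hk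
  obtain ⟨t, -, rfl⟩ := hk
  rw [← C_mul] at hTP hTQ
  constructor
  · by_contra h0
    exact hform P m hP hm (Nat.pos_of_ne_zero h0) _ hTP
  · by_contra h0
    exact hform Q n hQ hn (Nat.pos_of_ne_zero h0) _ hTQ

theorem exists_eq_mul_isCoprime {R : Type*} [EuclideanDomain R] {p : R} (hp : p ≠ 0) (q : R) :
    ∃ g p' q' : R, g ≠ 0 ∧ IsCoprime p' q' ∧ p = g * p' ∧ q = g * q' := by
  classical
  have hg : EuclideanDomain.gcd p q ≠ 0 := fun h0 => hp (EuclideanDomain.gcd_eq_zero_iff.mp h0).1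
  obtain ⟨p', hp'⟩ := EuclideanDomain.gcd_dvd_left p q
  obtain ⟨q', hq'⟩ := EuclideanDomain.gcd_dvd_right p q
  have hab := EuclideanDomain.gcd_eq_gcd_ab p q
  refine ⟨_, p', q', hg,
    ⟨EuclideanDomain.gcdA p q, EuclideanDomain.gcdB p q, mul_left_cancel₀ hg ?_⟩, hp', hq'⟩
  linear_combination -hab - EuclideanDomain.gcdA p q * hp' - EuclideanDomain.gcdB p q * hq'

/-- After the gcd is cancelled, the surplus X^(j-j') is absorbed into the formal degree of P. The
coprime case then forces everything to degree zero, and `hmul` compares the constants. -/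
theorem exponents_eq_of_skewForm_mul_eq_of_le {a : K} (ha : a ≠ 0)
    (hform : ∀ (P : K[X]) (N : ℕ), P ≠ 0 → P.natDegree ≤ N → 0 < N → ∀ γ : K,
      skewForm σ z N P ≠ C γ * P)
    (hmul : ∀ (f : K) (i j : ℕ), f ≠ 0 → σ f * a ^ i = f * a ^ j → i = j)
    {P Q : K[X]} (hP : P ≠ 0) (hQ : Q ≠ 0) {N : ℕ} (hPN : P.natDegree ≤ N) (hQN : Q.natDegree ≤ N)
    {i j i' j' : ℕ} (hj : j' ≤ j)
    (h : skewForm σ z N P * X ^ j * C (a ^ i) * Q = P * (skewForm σ z N Q * X ^ j' * C (a ^ i'))) :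
    i = i' ∧ j = j' := by
  obtain ⟨G, P₁, Q₁, hG, hcop, rfl, rfl⟩ : ∃ G P₁ Q₁ : K[X], G ≠ 0 ∧ IsCoprime P₁ Q₁ ∧
      P = G * P₁ ∧ Q = G * Q₁ := by
    exact exists_eq_mul_isCoprime hP Q
  have hP₁ : P₁ ≠ 0 := right_ne_zero_of_mul hP
  have hQ₁ : Q₁ ≠ 0 := right_ne_zero_of_mul hQ
  rw [natDegree_mul hG hP₁] at hPN
  rw [natDegree_mul hG hQ₁] at hQN
  obtain ⟨J, rfl⟩ := Nat.exists_eq_add_of_le hj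
  -- The least admissible n, so that one of the two formal degrees is exact.
  obtain ⟨n, hn, hnP, hmn⟩ : ∃ n, Q₁.natDegree ≤ n ∧ P₁.natDegree ≤ n + J ∧
      (n + J = P₁.natDegree ∨ n = Q₁.natDegree) :=
    ⟨max Q₁.natDegree (P₁.natDegree - J), by omega, by omega, by omega⟩
  have key : skewForm σ z (n + J) P₁ * C (a ^ i) * Q₁ = P₁ * skewForm σ z n Q₁ * C (a ^ i') := by
    set M := N - G.natDegree
    have hN : N = G.natDegree + M := by omega
    have e1 : skewForm σ z N (G * P₁) = skewForm σ z G.natDegree G * skewForm σ z M P₁ := by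
      rw [hN, skewForm_mul le_rfl (by omega)]
    have e2 : skewForm σ z N (G * Q₁) = skewForm σ z G.natDegree G * skewForm σ z M Q₁ := by
      rw [hN, skewForm_mul le_rfl (by omega)]
    have e3 : skewForm σ z M P₁ * X ^ J * X ^ n = skewForm σ z (n + J) P₁ * X ^ M := by
      rw [← skewForm_add_right (by omega), ← skewForm_add_right (by omega),
        ← skewForm_add_right (by omega)]
      congr 1; ring
    have e4 : skewForm σ z M Q₁ * X ^ n = skewForm σ z n Q₁ * X ^ M := by
      rw [← skewForm_add_right (by omega), ← skewForm_add_right (by omega), add_comm]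
    have hne : skewForm σ z G.natDegree G * G * X ^ j' * X ^ M ≠ 0 := by
      simp [skewForm_eq_zero_iff, hG]
    apply mul_left_cancel₀ hne
    rw [e1, e2, pow_add] at h
    linear_combination X ^ n * h
      - skewForm σ z G.natDegree G * G * X ^ j' * C (a ^ i) * Q₁ * e3
      + skewForm σ z G.natDegree G * G * X ^ j' * P₁ * C (a ^ i') * e4
  obtain ⟨h1, h2⟩ := eq_zero_of_isCoprime_of_skewForm_mul_eq hform hP₁ hQ₁ hcop hnP hn hmn
    (pow_ne_zero _ ha) key
  obtain rfl : n = 0 := h2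
  obtain rfl : J = 0 := by omega
  refine ⟨?_, rfl⟩
  rw [eq_C_of_natDegree_eq_zero (Nat.le_zero.mp hnP)] at key hP₁
  rw [eq_C_of_natDegree_eq_zero (Nat.le_zero.mp hn)] at key hQ₁
  set p := P₁.coeff 0
  set q := Q₁.coeff 0
  have hp : p ≠ 0 := fun h0 => hP₁ (by rw [h0, C_0])
  have hq : q ≠ 0 := fun h0 => hQ₁ (by rw [h0, C_0])
  rw [skewForm_zero_C, skewForm_zero_C, ← C_mul, ← C_mul, ← C_mul, ← C_mul] at key
  have key' := C_injective key
  refine hmul (p / q) i i' (div_ne_zero hp hq) ?_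
  have hσq : σ q ≠ 0 := (map_ne_zero σ).mpr hq
  rw [map_div₀]
  field_simp
  linear_combination key'

theorem exponents_eq_of_skewForm_mul_eq {a : K} (ha : a ≠ 0)
    (hform : ∀ (P : K[X]) (N : ℕ), P ≠ 0 → P.natDegree ≤ N → 0 < N → ∀ γ : K,
      skewForm σ z N P ≠ C γ * P)
    (hmul : ∀ (f : K) (i j : ℕ), f ≠ 0 → σ f * a ^ i = f * a ^ j → i = j)
    {P Q : K[X]} (hP : P ≠ 0) (hQ : Q ≠ 0) {N : ℕ} (hPN : P.natDegree ≤ N) (hQN : Q.natDegree ≤ N)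
    {i j i' j' : ℕ}
    (h : skewForm σ z N P * X ^ j * C (a ^ i) * Q = P * (skewForm σ z N Q * X ^ j' * C (a ^ i'))) :
    i = i' ∧ j = j' := by
  rcases le_total j' j with hj | hj
  · exact exponents_eq_of_skewForm_mul_eq_of_le ha hform hmul hP hQ hPN hQN hj h
  · have := exponents_eq_of_skewForm_mul_eq_of_le (i := i') (i' := i) ha hform hmul hQ hP hQN hPN hj
      (by linear_combination -h)
    exact ⟨this.1.symm, this.2.symm⟩

/-- A difference-algebraic criterion for the independence of a solution `S` of a first order
equation and a solution `B` of a second order equation with Riccati variable `u = σ B / B`. -/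
theorem algebraicIndependent_of_forall_skewForm_ne {τ : L →+* L}
    (hτ : ∀ k, τ (algebraMap K L k) = algebraMap K L (σ k)) {a : K} (ha : a ≠ 0)
    (hform : ∀ (P : K[X]) (N : ℕ), P ≠ 0 → P.natDegree ≤ N → 0 < N → ∀ γ : K,
      skewForm σ z N P ≠ C γ * P)
    (hmul : ∀ (f : K) (i j : ℕ), f ≠ 0 → σ f * a ^ i = f * a ^ j → i = j)
    {S B u : L} (hS0 : S ≠ 0) (hB0 : B ≠ 0) (hS : τ S = algebraMap K L a * S) (hB : τ B = u * B)
    (hu : u * τ u = 1 - algebraMap K L z * u) : AlgebraicIndependent K ![S, B] := by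
  have htr := transcendental_of_forall_skewForm_ne hτ hu hform
  set Θ : MvPolynomial (Fin 2) K[X] →+* L :=
    MvPolynomial.eval₂Hom ((aeval u : K[X] →ₐ[K] L) : K[X] →+* L) ![S, B] with hΘ
  have hΘmon : ∀ (m : Fin 2 →₀ ℕ) (e : K[X]),
      Θ (MvPolynomial.monomial m e) = aeval u e * (S ^ m 0 * B ^ m 1) := by
    intro m e
    rw [hΘ, MvPolynomial.coe_eval₂Hom, MvPolynomial.eval₂_monomial,
      Finsupp.prod_fintype _ _ (by simp)]
    simp [Fin.prod_univ_two]
  -- Induction on the number of monomials of a relation.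
  have hinj : ∀ (n : ℕ) (F : MvPolynomial (Fin 2) K[X]), F.support.card = n → Θ F = 0 → F = 0 := by
    intro n
    induction n using Nat.strong_induction_on with
    | _ n ih =>
    intro F hFn hF
    by_contra hF0
    obtain ⟨m₀, hm₀⟩ := MvPolynomial.support_nonempty.mpr hF0
    set N := F.support.sup fun m => (F.coeff m).natDegree
    have hN : ∀ m, (F.coeff m).natDegree ≤ N := by
      intro m
      by_cases hm : m ∈ F.support
      · exact Finset.le_sup (f := fun m => (F.coeff m).natDegree) hm
      · simp [MvPolynomial.notMem_support_iff.mp hm]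
    -- Coefficients of the relation obtained by applying `τ` and multiplying by u^N; S contributes
    -- powers of a, and B powers of u.
    let e : (Fin 2 →₀ ℕ) → K[X] := fun m => skewForm σ z N (F.coeff m) * X ^ m 1 * C (a ^ m 0)
    let F' : MvPolynomial (Fin 2) K[X] := ∑ m ∈ F.support, MvPolynomial.monomial m (e m)
    have hF'coeff : ∀ m, F'.coeff m = e m := by
      intro m
      simp only [F', MvPolynomial.coeff_sum, MvPolynomial.coeff_monomial]
      rw [Finset.sum_ite_eq' F.support m]
      split_ifs with hm
      · rfl
      · simp only [e]
        rw [MvPolynomial.notMem_support_iff.mp hm, skewForm_eq_zero_iff.mpr rfl]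
        simp
    have hF' : Θ F' = 0 := by
      have h1 : u ^ N * τ (Θ F) = 0 := by rw [hF, map_zero, mul_zero]
      rw [← h1]
      conv_rhs => rw [F.as_sum]
      simp only [F', map_sum, Finset.mul_sum, hΘmon]
      refine Finset.sum_congr rfl fun m _ => ?_
      simp only [e, map_mul, map_pow, aeval_X, aeval_C, aeval_skewForm hτ hu (hN m), hS, hB]
      ring
    -- The monomial m₀ cancels and no new one appears, so this smaller relation is trivial.
    have hcross : MvPolynomial.C (e m₀) * F - MvPolynomial.C (F.coeff m₀) * F' = 0 := by
      refine ih _ ?_ _ rfl (by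
      rw [RingHom.map_sub, RingHom.map_mul Θ _ F, RingHom.map_mul Θ _ F', hF, hF', mul_zero,
        mul_zero, sub_zero])
      rw [← hFn]
      apply Finset.card_lt_card
      rw [Finset.ssubset_iff_of_subset]
      · refine ⟨m₀, hm₀, ?_⟩
        rw [MvPolynomial.notMem_support_iff, MvPolynomial.coeff_sub, MvPolynomial.coeff_C_mul,
          MvPolynomial.coeff_C_mul, hF'coeff, mul_comm, sub_self]
      · intro m hm
        by_contra hmF
        rw [MvPolynomial.mem_support_iff, MvPolynomial.coeff_sub, MvPolynomial.coeff_C_mul,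
          MvPolynomial.coeff_C_mul, hF'coeff] at hm
        apply hm
        simp only [e]
        rw [MvPolynomial.notMem_support_iff.mp hmF, skewForm_eq_zero_iff.mpr rfl]
        simp
    by_cases hsing : ∃ m ∈ F.support, m ≠ m₀
    · obtain ⟨m, hm, hmm⟩ := hsing
      have h2 := congrArg (MvPolynomial.coeff m) hcross
      rw [MvPolynomial.coeff_sub, MvPolynomial.coeff_C_mul, MvPolynomial.coeff_C_mul, hF'coeff,
        MvPolynomial.coeff_zero, sub_eq_zero] at h2
      obtain ⟨h3, h4⟩ := exponents_eq_of_skewForm_mul_eq ha hform hmul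
        (MvPolynomial.mem_support_iff.mp hm₀) (MvPolynomial.mem_support_iff.mp hm)
        (hN m₀) (hN m) h2
      apply hmm
      ext i
      fin_cases i
      · exact h3.symm
      · exact h4.symm
    · push Not at hsing
      have hsupp : F.support = {m₀} :=
        Finset.eq_singleton_iff_unique_mem.mpr ⟨hm₀, hsing⟩
      rw [F.as_sum, hsupp, Finset.sum_singleton, hΘmon] at hF
      have h5 : aeval u (F.coeff m₀) ≠ 0 := fun h0 =>
        MvPolynomial.mem_support_iff.mp hm₀ ((transcendental_iff.mp htr) _ h0)
      exact mul_ne_zero h5 (mul_ne_zero (pow_ne_zero _ hS0) (pow_ne_zero _ hB0)) hF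
  rw [algebraicIndependent_iff]
  intro p hp
  have h6 : MvPolynomial.map (C : K →+* K[X]) p = 0 := by
    refine hinj _ _ rfl ?_
    rw [hΘ, MvPolynomial.coe_eval₂Hom, MvPolynomial.eval₂_map, ← hp, MvPolynomial.aeval_def]
    congr 1
    ext k
    simp
  exact MvPolynomial.map_injective _ C_injective (by rw [h6, map_zero])

end SkewForms

/-! ### Transcendence degree of the generated field -/

section TranscendenceDegree

/-- The field generated by an algebraically independent family has the expected transcendence
degree. -/
theorem AlgebraicIndependent.trdeg_adjoin_range {ι F E : Type} [Field F] [Field E] [Algebra F E]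
    {x : ι → E} (hx : AlgebraicIndependent F x) :
    Algebra.trdeg F (IntermediateField.adjoin F (Set.range x)) = Cardinal.mk ι := by
  rw [← hx.aevalEquivField.trdeg_eq,
    ← trdeg_add_eq F (MvPolynomial ι F) (A := FractionRing (MvPolynomial ι F))]
  have : Algebra.IsAlgebraic (MvPolynomial ι F) (FractionRing (MvPolynomial ι F)) :=
    IsLocalization.isAlgebraic _ (nonZeroDivisors (MvPolynomial ι F))
  rw [MvPolynomial.trdeg_of_isDomain, trdeg_eq_zero]
  simp

end TranscendenceDegree

/-! ### Mahler equations of the two series -/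

section FunctionalEquations

theorem X_mul_sternSeries : PowerSeries.X * sternSeries =
    (1 + PowerSeries.X + PowerSeries.X ^ 2) * PowerSeries.expand 2 two_ne_zero sternSeries := by
  have hS : ∀ n, PowerSeries.coeff n sternSeries = (sternSeq n : ℂ) :=
    fun n => PowerSeries.coeff_mk n _
  ext n
  rcases n with _ | _ | n
  · have h0 : PowerSeries.constantCoeff sternSeries = 0 := by
      rw [← PowerSeries.coeff_zero_eq_constantCoeff_apply, hS, sternSeq_zero, Nat.cast_zero]
    simp [PowerSeries.constantCoeff_expand, h0]
  · rw [add_mul, add_mul, one_mul, map_add, map_add, PowerSeries.coeff_succ_X_mul,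
      PowerSeries.coeff_succ_X_mul, PowerSeries.coeff_X_pow_mul', PowerSeries.coeff_expand,
      PowerSeries.coeff_expand]
    simp [hS, sternSeq_zero]
  · rw [add_mul, add_mul, one_mul, map_add, map_add, PowerSeries.coeff_succ_X_mul,
      PowerSeries.coeff_succ_X_mul, PowerSeries.coeff_X_pow_mul', PowerSeries.coeff_expand,
      PowerSeries.coeff_expand, PowerSeries.coeff_expand, if_pos (by omega : 2 ≤ n + 1 + 1), hS]
    rcases Nat.even_or_odd' n with ⟨m, rfl | rfl⟩
    · rw [if_pos (by omega), if_neg (by omega), if_pos (by omega), hS, hS,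
        show (2 * m + 1 + 1) / 2 = m + 1 by omega, show (2 * m + 1 + 1 - 2) / 2 = m by omega,
        sternSeq_two_mul_add_one]
      push_cast
      ring
    · rw [if_neg (by omega), if_pos (by omega), if_neg (by omega), hS,
        show (2 * m + 1 + 1) / 2 = m + 1 by omega, show 2 * m + 1 + 1 = 2 * (m + 1) by ring,
        sternSeq_two_mul]
      ring

theorem baumSweetSeries_eq : baumSweetSeries =
    PowerSeries.X * PowerSeries.expand 2 two_ne_zero baumSweetSeries +
      PowerSeries.expand 2 two_ne_zero (PowerSeries.expand 2 two_ne_zero baumSweetSeries) := by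
  have hB : ∀ n, PowerSeries.coeff n baumSweetSeries = (baumSweetSeq n : ℂ) :=
    fun n => PowerSeries.coeff_mk n _
  ext n
  rcases n with _ | n
  · simp [PowerSeries.constantCoeff_expand]
  · rw [map_add, PowerSeries.coeff_succ_X_mul, PowerSeries.coeff_expand, PowerSeries.coeff_expand,
      hB]
    rcases Nat.even_or_odd' n with ⟨m, rfl | rfl⟩
    · rw [if_pos (by omega), if_neg (by omega), hB, show 2 * m / 2 = m by omega,
        baumSweetSeq_two_mul_add_one, add_zero]
    · rw [if_neg (by omega), if_pos (by omega), PowerSeries.coeff_expand, zero_add]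
      rcases Nat.even_or_odd' m with ⟨k, rfl | rfl⟩
      · rw [if_neg (by omega), show 2 * (2 * k) + 1 + 1 = 4 * k + 2 by ring,
          baumSweetSeq_four_mul_add_two, Nat.cast_zero]
      · rw [if_pos (by omega), hB, show 2 * (2 * k + 1) + 1 + 1 = 4 * (k + 1) by ring,
          baumSweetSeq_four_mul]
        congr 2
        omega

theorem sternSeries_ne_zero : sternSeries ≠ 0 := by
  intro h
  have : PowerSeries.coeff 1 sternSeries = (sternSeq 1 : ℂ) := PowerSeries.coeff_mk _ _
  rw [h, sternSeq_one] at this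
  simp at this

theorem baumSweetSeries_ne_zero : baumSweetSeries ≠ 0 := by
  intro h
  have : PowerSeries.coeff 0 baumSweetSeries = (baumSweetSeq 0 : ℂ) := PowerSeries.coeff_mk _ _
  rw [h, baumSweetSeq_zero] at this
  simp at this

theorem PowerSeries.expand_injective {R : Type*} [CommRing R] {p : ℕ} (hp : p ≠ 0) :
    Function.Injective (PowerSeries.expand p hp : PowerSeries R → PowerSeries R) := by
  intro f g h
  ext n
  rw [← PowerSeries.coeff_expand_mul p hp f n, h, PowerSeries.coeff_expand_mul]

end FunctionalEquations

/-! ### Multiplicities at the primitive cube roots of unity -/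

section Multiplicities

open Polynomial

/-- x² - w² = (x-w)(x+w), and w ≠ -w because w ≠ 0. -/
theorem Polynomial.rootMultiplicity_expand_two (p : ℂ[X]) (hp : p ≠ 0) {w : ℂ} (hw : w ≠ 0) :
    (expand ℂ 2 p).rootMultiplicity w = p.rootMultiplicity (w ^ 2) := by
  obtain ⟨q, hpq, hq⟩ := p.exists_eq_pow_rootMultiplicity_mul_and_not_dvd hp (w ^ 2)
  set m := p.rootMultiplicity (w ^ 2)
  have hfac : expand ℂ 2 p = (X - C w) ^ m * ((X + C w) ^ m * expand ℂ 2 q) := by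
    rw [hpq, map_mul, map_pow, map_sub, expand_X, expand_C, ← mul_assoc, ← mul_pow, C_pow]
    congr 2
    ring
  have hroot : ¬ ((X + C w) ^ m * expand ℂ 2 q).IsRoot w := by
    rw [dvd_iff_isRoot] at hq
    rw [IsRoot.def, eval_mul, expand_eval, eval_pow, eval_add, eval_X, eval_C, ← two_mul]
    exact mul_ne_zero (pow_ne_zero _ (mul_ne_zero two_ne_zero hw)) hq
  have hne : (X - C w) ^ m * ((X + C w) ^ m * expand ℂ 2 q) ≠ 0 := by
    rw [← hfac]
    exact (expand_ne_zero two_pos).mpr hp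
  rw [hfac, rootMultiplicity_mul hne, rootMultiplicity_X_sub_C_pow,
    rootMultiplicity_eq_zero hroot, add_zero]

/-- Squaring swaps the two roots of 1 + X + X². Adding the multiplicity equations at both roots
cancels the contributions of p and q and leaves 2j = 2i. -/
theorem exponents_eq_of_expand_mul_eq {p q : ℂ[X]} (hp : p ≠ 0) (hq : q ≠ 0) {i j : ℕ}
    (h : expand ℂ 2 p * q * (X ^ i * (1 + X + X ^ 2) ^ j) =
      p * expand ℂ 2 q * (X ^ j * (1 + X + X ^ 2) ^ i)) : i = j := by
  obtain ⟨w, hw⟩ : ∃ w : ℂ, w ^ 2 + w + 1 = 0 := by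
    obtain ⟨w, hw⟩ := IsAlgClosed.exists_root (X ^ 2 + X + 1 : ℂ[X])
      (by rw [show (X ^ 2 + X + 1 : ℂ[X]).degree = 2 by compute_degree!]; decide)
    exact ⟨w, by simpa using hw⟩
  have hw0 : w ≠ 0 := by rintro rfl; simp at hw
  have hw2 : w ^ 2 ≠ w := by
    intro h2
    have h1 : w = 1 := by
      apply mul_left_cancel₀ hw0
      linear_combination h2
    rw [h1] at hw
    norm_num at hw
  have hw4 : (w ^ 2) ^ 2 = w := by linear_combination (w ^ 2 - w) * hw
  have hfac : (1 + X + X ^ 2 : ℂ[X]) = (X - C w) * (X - C (w ^ 2)) := by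
    have h1 : (C w : ℂ[X]) ^ 2 + C w + 1 = 0 := by
      rw [← C_pow, ← C_add, ← C_1, ← C_add, hw, C_0]
    rw [C_pow]
    linear_combination (X - C w + 1) * h1
  have hq0 : (X - C w) * (X - C (w ^ 2)) ≠ 0 :=
    mul_ne_zero (X_sub_C_ne_zero _) (X_sub_C_ne_zero _)
  have hroot : ∀ v, v ≠ 0 → (v = w ∨ v = w ^ 2) → ∀ (f g : ℂ[X]) (k l : ℕ), f ≠ 0 → g ≠ 0 →
      (expand ℂ 2 f * g * (X ^ k * (1 + X + X ^ 2) ^ l)).rootMultiplicity v =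
        f.rootMultiplicity (v ^ 2) + g.rootMultiplicity v + l := by
    intro v hv hvw f g k l hf hg
    have hf' : expand ℂ 2 f ≠ 0 := (expand_ne_zero two_pos).mpr hf
    have hX : (X ^ k : ℂ[X]) ≠ 0 := pow_ne_zero _ X_ne_zero
    have h1 : (X ^ k : ℂ[X]).rootMultiplicity v = 0 :=
      rootMultiplicity_eq_zero (by simp [IsRoot.def, hv])
    have h2 : ((X - C w) ^ l).rootMultiplicity v + ((X - C (w ^ 2)) ^ l).rootMultiplicity v = l := by
      rcases hvw with rfl | rfl
      · rw [rootMultiplicity_X_sub_C_pow, rootMultiplicity_eq_zero, add_zero]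
        simp only [IsRoot.def, eval_pow, eval_sub, eval_X, eval_C]
        exact pow_ne_zero _ (sub_ne_zero.mpr hw2.symm)
      · rw [rootMultiplicity_X_sub_C_pow, rootMultiplicity_eq_zero, zero_add]
        simp only [IsRoot.def, eval_pow, eval_sub, eval_X, eval_C]
        exact pow_ne_zero _ (sub_ne_zero.mpr hw2)
    have h3 := pow_ne_zero l (X_sub_C_ne_zero w)
    have h4 := pow_ne_zero l (X_sub_C_ne_zero (w ^ 2))
    rw [hfac, mul_pow, rootMultiplicity_mul
      (mul_ne_zero (mul_ne_zero hf' hg) (mul_ne_zero hX (mul_ne_zero h3 h4))),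
      rootMultiplicity_mul (mul_ne_zero hf' hg),
      rootMultiplicity_mul (mul_ne_zero hX (mul_ne_zero h3 h4)),
      rootMultiplicity_mul (mul_ne_zero h3 h4), h1, h2, rootMultiplicity_expand_two f hf hv,
      zero_add]
  rw [mul_comm p] at h
  have e1 := congrArg (rootMultiplicity w) h
  have e2 := congrArg (rootMultiplicity (w ^ 2)) h
  rw [hroot w hw0 (Or.inl rfl) _ _ _ _ hp hq, hroot w hw0 (Or.inl rfl) _ _ _ _ hq hp] at e1
  rw [hroot _ (pow_ne_zero 2 hw0) (Or.inr rfl) _ _ _ _ hp hq,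
    hroot _ (pow_ne_zero 2 hw0) (Or.inr rfl) _ _ _ _ hq hp, hw4] at e2
  omega

end Multiplicities

/-! ### Application to the Stern and Baum–Sweet series -/

section Main

open Polynomial

theorem X_div_pow_exponents_eq {σ : RatFunc ℂ →+* RatFunc ℂ}
    (hσ : ∀ p : ℂ[X], σ (algebraMap ℂ[X] (RatFunc ℂ) p) =
      algebraMap ℂ[X] (RatFunc ℂ) (expand ℂ 2 p))
    (f : RatFunc ℂ) (i j : ℕ) (hf : f ≠ 0)
    (h : σ f * (RatFunc.X / (1 + RatFunc.X + RatFunc.X ^ 2)) ^ i =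
      f * (RatFunc.X / (1 + RatFunc.X + RatFunc.X ^ 2)) ^ j)
    (hq : (1 + RatFunc.X + RatFunc.X ^ 2 : RatFunc ℂ) ≠ 0) : i = j := by
  have hinj : Function.Injective (algebraMap ℂ[X] (RatFunc ℂ)) := IsFractionRing.injective _ _
  have hn : f.num ≠ 0 := RatFunc.num_ne_zero hf
  have hd : f.denom ≠ 0 := f.denom_ne_zero
  refine exponents_eq_of_expand_mul_eq hn hd (hinj ?_)
  have hd' : algebraMap ℂ[X] (RatFunc ℂ) f.denom ≠ 0 := fun h0 => hd (hinj (by rw [h0, map_zero]))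
  have hd'' : algebraMap ℂ[X] (RatFunc ℂ) (expand ℂ 2 f.denom) ≠ 0 := fun h0 =>
    (expand_ne_zero two_pos).mpr hd (hinj (by rw [h0, map_zero]))
  rw [← RatFunc.num_div_denom f, map_div₀, hσ, hσ, RatFunc.num_div_denom] at h
  -- The first two occurrences of `f` sit inside `f.num` and `f.denom`; only the factor on the right
  -- is rewritten.
  nth_rewrite 3 [← RatFunc.num_div_denom f] at h
  simp only [map_mul, map_pow, map_add, map_one, RatFunc.algebraMap_X]
  rw [div_pow, div_pow] at h
  field_simp at h
  linear_combination h

theorem algebraicIndependent_sternSeries_baumSweetSeries :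
    AlgebraicIndependent (RatFunc ℂ)
      ![(sternSeries : LaurentSeries ℂ), (baumSweetSeries : LaurentSeries ℂ)] := by
  have hexp : Function.Injective (expand ℂ 2 : ℂ[X] →+* ℂ[X]) := expand_injective two_pos
  have hexp' : Function.Injective
      (PowerSeries.expand 2 two_ne_zero : PowerSeries ℂ →ₐ[ℂ] PowerSeries ℂ).toRingHom :=
    PowerSeries.expand_injective two_ne_zero
  -- Both maps are z ↦ z², extended from polynomials and from power series to their fraction fields.
  let σ : RatFunc ℂ →+* RatFunc ℂ := IsFractionRing.map hexp
  let τ : LaurentSeries ℂ →+* LaurentSeries ℂ := IsFractionRing.map hexp'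
  have hσ : ∀ p : ℂ[X], σ (algebraMap ℂ[X] (RatFunc ℂ) p) =
      algebraMap ℂ[X] (RatFunc ℂ) (expand ℂ 2 p) := fun p => IsLocalization.map_eq _ p
  have hτ : ∀ f : PowerSeries ℂ, τ (f : LaurentSeries ℂ) =
      ((PowerSeries.expand 2 two_ne_zero f : PowerSeries ℂ) : LaurentSeries ℂ) :=
    fun f => IsLocalization.map_eq _ f
  have hcoe : ∀ p : ℂ[X], PowerSeries.expand 2 two_ne_zero (p : PowerSeries ℂ) =
      ((expand ℂ 2 p : ℂ[X]) : PowerSeries ℂ) := by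
    intro p
    ext n
    rw [PowerSeries.coeff_expand, Polynomial.coeff_coe, Polynomial.coeff_coe, coeff_expand two_pos]
  have halg : ∀ p : ℂ[X], algebraMap (RatFunc ℂ) (LaurentSeries ℂ)
      (algebraMap ℂ[X] (RatFunc ℂ) p) = ((p : PowerSeries ℂ) : LaurentSeries ℂ) :=
    fun p => (RatFunc.coe_coe p).symm
  have hcomm : ∀ k, τ (algebraMap (RatFunc ℂ) (LaurentSeries ℂ) k) =
      algebraMap (RatFunc ℂ) (LaurentSeries ℂ) (σ k) := by
    have : τ.comp (algebraMap (RatFunc ℂ) (LaurentSeries ℂ)) =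
        (algebraMap (RatFunc ℂ) (LaurentSeries ℂ)).comp σ := by
      apply IsLocalization.ringHom_ext (nonZeroDivisors ℂ[X])
      refine RingHom.ext fun p => ?_
      simp only [RingHom.comp_apply]
      rw [halg, hτ, hσ, halg, hcoe]
    exact fun k => RingHom.congr_fun this k
  have hX : algebraMap (RatFunc ℂ) (LaurentSeries ℂ) RatFunc.X =
      ((PowerSeries.X : PowerSeries ℂ) : LaurentSeries ℂ) := by
    rw [← RatFunc.algebraMap_X, halg, Polynomial.coe_X]
  have hq : (1 + RatFunc.X + RatFunc.X ^ 2 : RatFunc ℂ) ≠ 0 := by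
    have h1 : (1 + X + X ^ 2 : ℂ[X]) ≠ 0 := by
      intro h0
      simpa using congrArg (eval 0) h0
    have h2 := (map_ne_zero_iff _ (IsFractionRing.injective ℂ[X] (RatFunc ℂ))).mpr h1
    simpa using h2
  have hinj : Function.Injective (HahnSeries.ofPowerSeries ℤ ℂ) :=
    HahnSeries.ofPowerSeries_injective
  have hB0 : (baumSweetSeries : LaurentSeries ℂ) ≠ 0 :=
    (map_ne_zero_iff _ hinj).mpr baumSweetSeries_ne_zero
  have hS0 : (sternSeries : LaurentSeries ℂ) ≠ 0 :=
    (map_ne_zero_iff _ hinj).mpr sternSeries_ne_zero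
  have hτB0 : τ (baumSweetSeries : LaurentSeries ℂ) ≠ 0 := (map_ne_zero τ).mpr hB0
  refine algebraicIndependent_of_forall_skewForm_ne (z := RatFunc.X)
    (a := RatFunc.X / (1 + RatFunc.X + RatFunc.X ^ 2))
    (u := τ (baumSweetSeries : LaurentSeries ℂ) / (baumSweetSeries : LaurentSeries ℂ))
    hcomm (div_ne_zero RatFunc.X_ne_zero hq)
    (fun P N hP hN hpos γ => skewForm_ne_C_mul hσ hP hN hpos γ)
    (fun f i j hf h => X_div_pow_exponents_eq hσ f i j hf h hq) hS0 hB0 ?_ ?_ ?_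
  · have h := congrArg (fun f : PowerSeries ℂ => (f : LaurentSeries ℂ)) X_mul_sternSeries
    have hq' : (1 + (PowerSeries.X : PowerSeries ℂ) + (PowerSeries.X : PowerSeries ℂ) ^ 2 :
        LaurentSeries ℂ) ≠ 0 := by
      have := (map_ne_zero (algebraMap (RatFunc ℂ) (LaurentSeries ℂ))).mpr hq
      rwa [map_add, map_add, map_one, map_pow, hX] at this
    simp only [map_mul, map_add, map_one, map_pow, ← hτ] at h
    rw [map_div₀, map_add, map_add, map_one, map_pow, hX, div_mul_eq_mul_div, eq_div_iff hq', h]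
    ring
  · rw [div_mul_cancel₀ _ hB0]
  · have h := congrArg (fun f : PowerSeries ℂ => (f : LaurentSeries ℂ)) baumSweetSeries_eq
    simp only [map_mul, map_add, ← hτ] at h
    rw [hX, map_div₀]
    field_simp
    linear_combination -h

end Main

theorem mainTheorem10 :
    AlgebraicIndependent (RatFunc ℂ)
        ![(sternSeries : LaurentSeries ℂ), (baumSweetSeries : LaurentSeries ℂ)] ∧
      Algebra.trdeg (RatFunc ℂ)
        (IntermediateField.adjoin (RatFunc ℂ)
          ({(sternSeries : LaurentSeries ℂ), (baumSweetSeries : LaurentSeries ℂ)} :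
            Set (LaurentSeries ℂ))) = 2 := by
  refine ⟨algebraicIndependent_sternSeries_baumSweetSeries, ?_⟩
  have h := algebraicIndependent_sternSeries_baumSweetSeries.trdeg_adjoin_range
  rw [Matrix.range_cons, Matrix.range_cons, Matrix.range_empty, Set.union_empty,
    Set.singleton_union] at h
  rw [h]
  simp
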